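/- Let $G$ be a finite simple connected graph of order $n$ that is non-Eulerian, i.e. has no closed trail containing all of its edges. For $v\in V(G)$ let $E_G(v)$ be the set of edges incident with $v$, and for $f:E(G)\to\{-1,1\}$ and $S\subseteq E(G)$ put $f(S)=\sum_{e\in S}f(e)$. For a positive integer $j\le n$, a signed $j$-submatching of $G$ is a function $f:E(G)\to\{-1,1\}$ such that $f(E_G(v))\le 1$ for at least $j$ vertices $v$, and $\beta_S^j(G)$ denotes the maximum of $f(E(G))$ over all signed $j$-submatchings $f$ of $G$. Let $2k$ be the number of vertices of odd degree of $G$. A complete partition of $G$ is a partition of $E(G)$ into exactly $k$ (edge sets of) trails, and $\eta(G)$ denotes the maximum, over all complete partitions $P$ of $G$, of the number of trails in $P$ with an odd number of edges. Then both maxima, $\beta_S^n(G)$ and $\eta(G)$, exist (in particular $G$ has a complete partition), and $$\beta_S^n(G)=\eta(G).$$ -/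

import Mathlib

namespace SimpleGraph

section SignedSubmatching

variable {V : Type*} [Fintype V] [DecidableEq V] (G : SimpleGraph V) [DecidableRel G.Adj]

/-- `f` is a signed `k`-submatching of `G`: it takes the values `1` and `-1` on the edges of `G`,
and the sum of `f` over the edges incident with `v` is at most `1` for at least `k` vertices `v`.
Only the restriction of `f` to the edges of `G` matters, here and below. -/
def IsSignedSubmatching (k : ℕ) (f : Sym2 V → ℤ) : Prop :=
  (∀ e ∈ G.edgeFinset, f e = 1 ∨ f e = -1) ∧
    k ≤ (Finset.univ.filter fun v : V => ∑ e ∈ G.incidenceFinset v, f e ≤ 1).card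

/-- The set of the total values `f(E(G))` of the signed `k`-submatchings `f` of `G`. -/
def signedSubmatchingValues (k : ℕ) : Set ℤ :=
  {s | ∃ f : Sym2 V → ℤ, G.IsSignedSubmatching k f ∧ s = ∑ e ∈ G.edgeFinset, f e}

/-- The signed `k`-submatching number of `G`. -/
noncomputable def signedSubmatchingNumber (k : ℕ) : ℤ :=
  sSup (G.signedSubmatchingValues k)

/-- `S` is the edge set of a trail of `G` (open or closed). -/
def IsTrailEdgeSet (S : Finset (Sym2 V)) : Prop :=
  ∃ (u v : V) (p : G.Walk u v), p.IsTrail ∧ p.edges.toFinset = S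

/-- A complete partition of `G`: a partition of the edge set into edge sets of trails whose number
is exactly `k`, where `2 * k` is the number of vertices of odd degree. -/
def IsCompletePartition (P : Finpartition G.edgeFinset) : Prop :=
  (∀ S ∈ P.parts, G.IsTrailEdgeSet S) ∧
    2 * P.parts.card = (Finset.univ.filter fun v : V => Odd (G.degree v)).card

/-- The number of parts with an odd number of edges. -/
def oddTrailCount (P : Finpartition G.edgeFinset) : ℕ :=
  (P.parts.filter fun S => Odd S.card).card

/-- The set of the numbers of odd trails in the complete partitions of `G`. -/
def oddTrailCounts : Set ℕ :=
  {t | ∃ P : Finpartition G.edgeFinset, G.IsCompletePartition P ∧ t = G.oddTrailCount P}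

/-- The maximal number of odd trails in a complete partition of `G`. -/
noncomputable def completePartitionEta : ℕ :=
  sSup G.oddTrailCounts

end SignedSubmatching

/-- A graph is Eulerian if it has a closed trail containing all its edges. -/
def IsEulerianGraph {V : Type*} [DecidableEq V] (G : SimpleGraph V) : Prop :=
  ∃ (v : V) (p : G.Walk v v), p.IsEulerian

end SimpleGraph

/-! Both inequalities come from signs alternating along trails.

From a complete partition `P` to a submatching: alternate signs along each trail, starting with `1`.
A trail then has value `1` or `0` according as its length is odd or even, and contributes to vertex
sums only at its ends. The `k` trails have `2k` ends, and by parity each of the `2k` odd vertices is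
an end; hence each is an end exactly once, no other vertex is one, and all vertex sums are at most
`1` (`IsCompletePartition.oddTrailCount_mem`).

Conversely, given `f`, view each edge as a walk with label `f e` at both ends, and join walks
wherever opposite labels meet. The labels at `v` add up to `f(E(v)) ≤ 1`, so in the end distinct
walks share only ends labelled `-1`, and closed walks have value at most `0` (`IsExact.isBounded`).
Next join at the shared `-1` ends and absorb closed walks into walks they meet
(`IsBounded.exists_pairwise`). A closed walk that survives meets no other walk, so by connectivity
it is an Eulerian trail, which is excluded. The remaining trails are open with distinct ends, which
must be the odd vertices; so there are `k` of them, each of value at most `1`, and at most `0` if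
its length is even. -/

namespace SimpleGraph

/-! ### Alternating signs along a trail -/

section Trails

variable {V : Type*} [DecidableEq V] {G : SimpleGraph V}

/-- The sum of `f` over the members of the list `l` incident with `v`. -/
def edgeSumAt (f : Sym2 V → ℤ) (l : List (Sym2 V)) (v : V) : ℤ :=
  (l.map fun e => if v ∈ e then f e else 0).sum

/-- The contribution to `v` of the labels `a`, `b` of the end vertices `u`, `w`. -/
def endSum (u w : V) (a b : ℤ) (v : V) : ℤ :=
  (if u = v then a else 0) + (if w = v then b else 0)

theorem sum_endSum [Fintype V] (u w : V) (a b : ℤ) : ∑ v, endSum u w a b v = a + b := by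
  simp [endSum, Finset.sum_add_distrib]

theorem sum_edgeSumAt [Fintype V] (f : Sym2 V → ℤ) (l : List (Sym2 V))
    (hl : ∀ e ∈ l, e ∈ G.edgeSet) : ∑ v, edgeSumAt f l v = 2 * (l.map f).sum := by
  induction l with
  | nil => simp [edgeSumAt]
  | cons e l ih =>
    have h1 : ∑ v, (if v ∈ e then f e else 0) = 2 * f e := by
      have he := hl e (by simp)
      induction e using Sym2.ind with
      | _ x y =>
        have hxy : x ≠ y := (G.mem_edgeSet.1 he).ne
        rw [← Finset.sum_filter, Finset.sum_const]
        have : (Finset.univ.filter fun v => v ∈ s(x, y)) = {x, y} := by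
          ext v; simp
        rw [this, Finset.card_pair hxy]; simp
    have h2 := ih fun e he => hl e (by simp [he])
    simp only [edgeSumAt, List.map_cons, List.sum_cons, Finset.sum_add_distrib] at h2 ⊢
    rw [h1, h2]; ring

theorem edgeSumAt_congr {f g : Sym2 V → ℤ} {l : List (Sym2 V)} (h : ∀ e ∈ l, f e = g e) (v : V) :
    edgeSumAt f l v = edgeSumAt g l v := by
  unfold edgeSumAt
  congr 1
  refine List.map_congr_left fun e he => ?_
  rw [h e he]

theorem Walk.IsTrail.exists_alternating {u w : V} {p : G.Walk u w} (hp : p.IsTrail) :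
    ∀ s : ℤ, s = 1 ∨ s = -1 → ∃ g : Sym2 V → ℤ, (∀ e, g e = 1 ∨ g e = -1) ∧
      ∀ v, edgeSumAt g p.edges v = endSum u w s (-s * (-1) ^ p.length) v := by
  induction p with
  | nil =>
    intro s hs
    -- On the empty walk the labels `s` and `-s` sit at the same vertex and cancel.
    refine ⟨fun _ => 1, by simp, fun v => ?_⟩
    simp only [edgeSumAt, endSum, Walk.edges_nil, Walk.length_nil]
    split_ifs <;> simp
  | @cons u x w h p ih =>
    intro s hs
    rw [Walk.isTrail_cons] at hp
    obtain ⟨g, hg, hg'⟩ := ih hp.1 (-s) (by omega)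
    refine ⟨Function.update g s(u, x) s, fun e => ?_, fun v => ?_⟩
    · by_cases he : e = s(u, x)
      · simpa [he] using hs
      · simpa [he] using hg e
    · have h1 : edgeSumAt (Function.update g s(u, x) s) p.edges v = edgeSumAt g p.edges v :=
        edgeSumAt_congr (fun e he => Function.update_of_ne (by rintro rfl; exact hp.2 he) _ _) v
      have h2 := hg' v
      rw [← h1] at h2
      have hne := h.ne
      simp only [edgeSumAt, endSum, Walk.edges_cons, List.map_cons, List.sum_cons,
        Walk.length_cons, Function.update_self, Sym2.mem_iff] at h2 ⊢
      rw [h2, pow_succ]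
      by_cases h3 : u = v
      · subst h3
        simp [hne, hne.symm]
      · by_cases h4 : x = v
        · subst h4
          simp [hne]
        · simp [h3, h4, Ne.symm h3, Ne.symm h4]

theorem IsTrailEdgeSet.exists_signs [Fintype V] {S : Finset (Sym2 V)} (h : G.IsTrailEdgeSet S) :
    ∃ (u w : V) (b : ℤ) (g : Sym2 V → ℤ), (b = 1 ∨ b = -1) ∧ (∀ e, g e = 1 ∨ g e = -1) ∧
      (∀ v, ∑ e ∈ S, (if v ∈ e then g e else 0) = endSum u w 1 b v) ∧
      ∑ e ∈ S, g e = if Odd S.card then 1 else 0 := by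
  obtain ⟨u, w, p, hp, rfl⟩ := h
  obtain ⟨g, hg, hg'⟩ := hp.exists_alternating 1 (by simp)
  refine ⟨u, w, -1 * (-1) ^ p.length, g, ?_, hg, fun v => ?_, ?_⟩
  rotate_left
  · rw [← hg' v, List.sum_toFinset _ hp.edges_nodup]; rfl
  · rw [List.sum_toFinset _ hp.edges_nodup, List.toFinset_card_of_nodup hp.edges_nodup,
      Walk.length_edges]
    change (p.edges.map g).sum = _
    -- Handshake count: twice the value of the trail is the sum `1 + b` of its end labels.
    have h1 := sum_edgeSumAt (G := G) g p.edges fun e he => p.edges_subset_edgeSet he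
    simp_rw [hg', sum_endSum] at h1
    split_ifs with h2
    · rw [h2.neg_one_pow] at h1; omega
    · rw [(Nat.not_odd_iff_even.1 h2).neg_one_pow] at h1; omega
  · rcases neg_one_pow_eq_or ℤ p.length with h | h <;> simp [h]

end Trails

/-! ### From a complete partition to a signed submatching -/

section CompletePartition

variable {V : Type*} [Fintype V] [DecidableEq V] {G : SimpleGraph V} [DecidableRel G.Adj]

theorem sum_incidenceFinset (f : Sym2 V → ℤ) (v : V) :
    ∑ e ∈ G.incidenceFinset v, f e = ∑ e ∈ G.edgeFinset, if v ∈ e then f e else 0 := by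
  rw [G.incidenceFinset_eq_filter v, Finset.sum_filter]

theorem isSignedSubmatching_card_iff {f : Sym2 V → ℤ} :
    G.IsSignedSubmatching (Fintype.card V) f ↔ (∀ e ∈ G.edgeFinset, f e = 1 ∨ f e = -1) ∧
      ∀ v, ∑ e ∈ G.edgeFinset, (if v ∈ e then f e else 0) ≤ 1 := by
  unfold IsSignedSubmatching
  refine and_congr_right fun _ => ?_
  simp_rw [sum_incidenceFinset]
  constructor
  · intro h v
    have := (Finset.card_eq_iff_eq_univ _).1 (le_antisymm (Finset.card_le_univ _) h)
    simpa using (Finset.ext_iff.1 this v).2 (Finset.mem_univ v)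
  · intro h
    rw [Finset.filter_true_of_mem fun v _ => h v, Finset.card_univ]

theorem sum_ite_emod_two {f : Sym2 V → ℤ} (hf : ∀ e ∈ G.edgeFinset, f e = 1 ∨ f e = -1) (v : V) :
    (∑ e ∈ G.edgeFinset, if v ∈ e then f e else 0) % 2 = (G.degree v : ℤ) % 2 := by
  rw [← card_incidenceFinset_eq_degree, Finset.card_eq_sum_ones, Nat.cast_sum,
    G.incidenceFinset_eq_filter v, Finset.sum_filter, Finset.sum_int_mod,
    Finset.sum_int_mod _ _ fun e => _]
  congr 1
  refine Finset.sum_congr rfl fun e he => ?_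
  rcases hf e he with h | h <;> split_ifs <;> simp [h]

theorem sum_edgeFinset_eq_sum_parts (P : Finpartition G.edgeFinset) (g : Sym2 V → ℤ) :
    ∑ e ∈ G.edgeFinset, g e = ∑ S ∈ P.parts, ∑ e ∈ S, g e := by
  conv_lhs => rw [← P.biUnion_parts]
  exact Finset.sum_biUnion P.supIndep.pairwiseDisjoint

theorem IsCompletePartition.oddTrailCount_mem [Nonempty V] {P : Finpartition G.edgeFinset}
    (hP : G.IsCompletePartition P) :
    (G.oddTrailCount P : ℤ) ∈ G.signedSubmatchingValues (Fintype.card V) := by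
  -- Membership in `P.parts` sits inside the existentials so that `choose` gives total functions;
  -- the values elsewhere are irrelevant.
  have h0 : ∀ S : Finset (Sym2 V), ∃ (u w : V) (b : ℤ) (g : Sym2 V → ℤ), S ∈ P.parts →
      (b = 1 ∨ b = -1) ∧ (∀ e, g e = 1 ∨ g e = -1) ∧
      (∀ v, ∑ e ∈ S, (if v ∈ e then g e else 0) = endSum u w 1 b v) ∧
      ∑ e ∈ S, g e = if Odd S.card then 1 else 0 := by
    intro S
    by_cases hS : S ∈ P.parts
    · obtain ⟨u, w, b, g, h⟩ := (hP.1 S hS).exists_signs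
      exact ⟨u, w, b, g, fun _ => h⟩
    · exact ⟨Classical.arbitrary V, Classical.arbitrary V, 0, 0, fun h => (hS h).elim⟩
  choose u w b g hb hg hv hsum using h0
  set f : Sym2 V → ℤ := fun e => g (P.part e) e with hf
  have hfS : ∀ S ∈ P.parts, ∀ e ∈ S, f e = g S e := fun S hS e he => by
    rw [hf]; simp only [P.part_eq_of_mem hS he]
  have hf1 : ∀ e ∈ G.edgeFinset, f e = 1 ∨ f e = -1 := fun e he => hg _ (P.part_mem.2 he) e
  have hfv : ∀ v, ∑ e ∈ G.edgeFinset, (if v ∈ e then f e else 0) =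
      ∑ S ∈ P.parts, endSum (u S) (w S) 1 (b S) v := fun v => by
    rw [sum_edgeFinset_eq_sum_parts P]
    refine Finset.sum_congr rfl fun S hS => ?_
    rw [← hv S hS v]
    exact Finset.sum_congr rfl fun e he => by rw [hfS S hS e he]
  -- `N v` counts the trail ends at `v`; as `b S` is odd, it has the parity of the vertex sum, hence
  -- of the degree.
  set N : V → ℤ := fun v => ∑ S ∈ P.parts, endSum (u S) (w S) 1 1 v with hN
  have hN0 : ∀ v, 0 ≤ N v := fun v => Finset.sum_nonneg fun S _ => by
    unfold endSum; split_ifs <;> simp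
  have hNmod : ∀ v, N v % 2 = (G.degree v : ℤ) % 2 := fun v => by
    rw [← sum_ite_emod_two hf1, hfv, hN, Finset.sum_int_mod, eq_comm, Finset.sum_int_mod]
    congr 1
    refine Finset.sum_congr rfl fun S hS => ?_
    unfold endSum
    rcases hb S hS with h | h <;> rw [h] <;> split_ifs <;> simp
  have hNle : ∀ v, (if Odd (G.degree v) then 1 else 0) ≤ N v := fun v => by
    have h1 := hN0 v
    have h2 := hNmod v
    split_ifs with h
    · obtain ⟨m, hm⟩ := h; omega
    · exact h1
  have hNsum : ∑ v, N v = ∑ v, (if Odd (G.degree v) then 1 else 0 : ℤ) := by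
    have h1 := hP.2
    simp only [hN]
    rw [Finset.sum_comm, Finset.sum_boole]
    simp_rw [sum_endSum, Finset.sum_const]
    rw [← h1]; simp [mul_comm]
  -- Termwise inequality with equal totals forces `N v` to be the indicator of odd degree.
  have hNeq := (Finset.sum_eq_sum_iff_of_le fun v _ => hNle v).1 hNsum.symm
  refine ⟨f, isSignedSubmatching_card_iff.2 ⟨hf1, fun v => ?_⟩, ?_⟩
  · rw [hfv]
    refine le_trans (Finset.sum_le_sum fun S hS => ?_) (show N v ≤ 1 from ?_)
    · unfold endSum
      rcases hb S hS with h | h <;> rw [h] <;> split_ifs <;> simp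
    · rw [← hNeq v (Finset.mem_univ v)]; split_ifs <;> simp
  · rw [sum_edgeFinset_eq_sum_parts P, oddTrailCount, Finset.card_filter, Nat.cast_sum]
    refine Finset.sum_congr rfl fun S hS => ?_
    rw [Finset.sum_congr rfl (hfS S hS), hsum S hS]
    push_cast; rfl

end CompletePartition

end SimpleGraph

/-! ### Merging the members of a list -/

namespace List

theorem exists_perm_of_not_pairwise {α : Type*} {r : α → α → Prop} {l : List α}
    (h : ¬ l.Pairwise r) : ∃ a b l', l.Perm (a :: b :: l') ∧ ¬ r a b := by
  induction l with
  | nil => simp at h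
  | cons a l ih =>
    by_cases hl : l.Pairwise r
    · rw [pairwise_cons, not_and_or, or_iff_left (not_not.2 hl)] at h
      push Not at h
      obtain ⟨b, hb, hab⟩ := h
      obtain ⟨l', hl'⟩ : ∃ l', l.Perm (b :: l') := by
        obtain ⟨s, t, rfl⟩ := append_of_mem hb
        exact ⟨s ++ t, perm_middle⟩
      exact ⟨a, b, l', hl'.cons a, hab⟩
    · obtain ⟨b, c, l', h1, h2⟩ := ih hl
      refine ⟨b, c, a :: l', (h1.cons a).trans ?_, h2⟩
      exact (Perm.swap b a (c :: l')).trans ((Perm.swap c a l').cons b)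

/-- If a pair of members violating `r` can always be merged into one member, then repeated merging
leads to a list all of whose pairs satisfy `r`. -/
theorem exists_pairwise_of_merge {α : Type*} {r : α → α → Prop} {Inv : List α → Prop}
    (hperm : ∀ l l', l.Perm l' → Inv l → Inv l')
    (hmerge : ∀ a b l, Inv (a :: b :: l) → ¬ r a b → ∃ c, Inv (c :: l)) (l : List α) (hl : Inv l) :
    ∃ l', Inv l' ∧ l'.Pairwise r := by
  induction hn : l.length using Nat.strong_induction_on generalizing l with
  | _ n ih =>
    by_cases hp : l.Pairwise r
    · exact ⟨l, hl, hp⟩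
    · obtain ⟨a, b, l', h1, h2⟩ := exists_perm_of_not_pairwise hp
      obtain ⟨c, hc⟩ := hmerge a b l' (hperm _ _ h1 hl) h2
      have := h1.length_eq
      simp only [length_cons] at this
      exact ih _ (by simp only [length_cons]; omega) _ hc rfl

theorem sum_map_flatMap {α β : Type*} (l : List α) (F : α → List β) (g : β → ℤ) :
    ((l.flatMap F).map g).sum = (l.map fun a => ((F a).map g).sum).sum := by
  induction l with
  | nil => simp
  | cons a l ih => simp [ih]

end List

/-! ### Decomposing the edges into labelled walks -/

namespace SimpleGraph

/-- A nontrivial walk with a label `1` or `-1` at each of its two ends. -/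
structure LabelledWalk {V : Type*} (G : SimpleGraph V) where
  /-- the first vertex -/
  fst : V
  /-- the last vertex -/
  lst : V
  /-- the walk -/
  walk : G.Walk fst lst
  /-- the label at the first vertex -/
  a : ℤ
  /-- the label at the last vertex -/
  b : ℤ
  ha : a = 1 ∨ a = -1
  hb : b = 1 ∨ b = -1
  edges_ne_nil : walk.edges ≠ []

namespace LabelledWalk

variable {V : Type*} {G : SimpleGraph V}

/-- `v` is an end of `T`, with label `s`. -/
def IsEnd (T : LabelledWalk G) (v : V) (s : ℤ) : Prop :=
  (T.fst = v ∧ T.a = s) ∨ (T.lst = v ∧ T.b = s)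

theorem IsEnd.eq_or {T : LabelledWalk G} {v : V} {s : ℤ} (h : T.IsEnd v s) : s = 1 ∨ s = -1 := by
  rcases h with ⟨_, rfl⟩ | ⟨_, rfl⟩
  · exact T.ha
  · exact T.hb

/-- The edges of the walks in `L` are exactly those in `E`, the labels bound the values of `f` on
the walks, and distinct walks share ends with labels `-1` only. -/
def IsBounded (f : Sym2 V → ℤ) (E : List (Sym2 V)) (L : List (LabelledWalk G)) : Prop :=
  (L.flatMap fun T => T.walk.edges).Perm E ∧
    (∀ T ∈ L, 2 * (T.walk.edges.map f).sum ≤ T.a + T.b ∧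
      (T.fst = T.lst → (T.walk.edges.map f).sum ≤ 0)) ∧
    L.Pairwise fun T₁ T₂ => ∀ v s t, T₁.IsEnd v s → T₂.IsEnd v t → s = -1 ∧ t = -1

/-- Two walks without common ends, and without common vertices if one of them is closed. -/
def Separate (T₁ T₂ : LabelledWalk G) : Prop :=
  (∀ v s t, T₁.IsEnd v s → ¬ T₂.IsEnd v t) ∧
    (T₁.fst = T₁.lst ∨ T₂.fst = T₂.lst → ∀ x ∈ T₁.walk.support, x ∉ T₂.walk.support)

theorem Separate.symm {T₁ T₂ : LabelledWalk G} (h : T₁.Separate T₂) : T₂.Separate T₁ :=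
  ⟨fun v s t h2 h1 => h.1 v t s h1 h2, fun hc x h2 h1 => h.2 hc.symm x h1 h2⟩

theorem IsBounded.perm {f : Sym2 V → ℤ} {E : List (Sym2 V)} {l l' : List (LabelledWalk G)}
    (hl : IsBounded f E l) (h : l.Perm l') : IsBounded f E l' :=
  ⟨(h.symm.flatMap_right _).trans hl.1, fun T hT => hl.2.1 T (h.mem_iff.2 hT),
    hl.2.2.perm h fun h v s t hs ht => (h v t s ht hs).symm⟩

variable [DecidableEq V]

/-- The sum of the labels of the ends of `T` at `v`. -/
def labelSum (T : LabelledWalk G) (v : V) : ℤ := endSum T.fst T.lst T.a T.b v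

/-- Walks can be reversed, so any two ends at `v` can be glued; their labels `s` and `t` drop out.
-/
theorem exists_join {T₁ T₂ : LabelledWalk G} {v : V} {s t : ℤ} (h₁ : T₁.IsEnd v s)
    (h₂ : T₂.IsEnd v t) : ∃ T : LabelledWalk G,
      T.walk.edges.Perm (T₁.walk.edges ++ T₂.walk.edges) ∧
      T₁.IsEnd T.fst T.a ∧ T₂.IsEnd T.lst T.b ∧
      T.a + T.b = T₁.a + T₁.b + T₂.a + T₂.b - s - t ∧
      ∀ x, T.labelSum x = T₁.labelSum x + T₂.labelSum x - if v = x then s + t else 0 := by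
  obtain ⟨u₁, w₁, p₁, a₁, b₁, ha₁, hb₁, hne₁⟩ := T₁
  obtain ⟨u₂, w₂, p₂, a₂, b₂, ha₂, hb₂, hne₂⟩ := T₂
  simp only [IsEnd, labelSum, endSum] at h₁ h₂ ⊢
  rcases h₁ with ⟨rfl, rfl⟩ | ⟨rfl, rfl⟩ <;> rcases h₂ with ⟨rfl, rfl⟩ | ⟨rfl, rfl⟩
  · refine ⟨⟨w₁, w₂, p₁.reverse.append p₂, b₁, b₂, hb₁, hb₂, by simp_all⟩, ?_, by simp, by simp,
      by ring, fun x => ?_⟩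
    · simpa using (List.reverse_perm _).append_right _
    · split_ifs <;> ring
  · refine ⟨⟨w₁, u₂, p₁.reverse.append p₂.reverse, b₁, a₂, hb₁, ha₂, by simp_all⟩, ?_, by simp,
      by simp, by ring, fun x => ?_⟩
    · simpa using (List.reverse_perm _).append (List.reverse_perm _)
    · split_ifs <;> ring
  · refine ⟨⟨u₁, w₂, p₁.append p₂, a₁, b₂, ha₁, hb₂, by simp_all⟩, by simp, by simp, by simp,
      by ring, fun x => ?_⟩
    split_ifs <;> ring
  · refine ⟨⟨u₁, u₂, p₁.append p₂.reverse, a₁, a₂, ha₁, ha₂, by simp_all⟩, ?_, by simp, by simp,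
      by ring, fun x => ?_⟩
    · simpa using (List.reverse_perm _).append_left _
    · split_ifs <;> ring

/-- The closed walk, rotated to start at `x`, is inserted into the other walk as a detour. -/
theorem exists_absorb {T₁ T₂ : LabelledWalk G} (h : T₁.fst = T₁.lst) {x : V}
    (h₁ : x ∈ T₁.walk.support) (h₂ : x ∈ T₂.walk.support) : ∃ T : LabelledWalk G,
      T.walk.edges.Perm (T₁.walk.edges ++ T₂.walk.edges) ∧
      T.fst = T₂.fst ∧ T.lst = T₂.lst ∧ T.a = T₂.a ∧ T.b = T₂.b := by
  obtain ⟨u₁, w₁, p₁, a₁, b₁, ha₁, hb₁, hne₁⟩ := T₁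
  obtain ⟨u₂, w₂, p₂, a₂, b₂, ha₂, hb₂, hne₂⟩ := T₂
  dsimp only at h h₁ h₂
  subst h
  have hp : ((p₂.takeUntil x h₂).append ((p₁.rotate x h₁).append (p₂.dropUntil x h₂))).edges.Perm
      (p₁.edges ++ p₂.edges) := by
    simp only [Walk.edges_append]
    refine (List.perm_append_comm_assoc _ _ _).trans ?_
    rw [← Walk.edges_append, Walk.take_spec]
    exact (p₁.rotate_edges x h₁).perm.append_right _
  refine ⟨⟨u₂, w₂, _, a₂, b₂, ha₂, hb₂, fun h0 => ?_⟩, hp, rfl, rfl, rfl, rfl⟩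
  rw [h0] at hp
  simp_all

theorem labelSum_nonneg {T : LabelledWalk G} {v : V} (h : ∀ s, T.IsEnd v s → s = 1) :
    0 ≤ T.labelSum v := by
  have h1 := h T.a
  have h2 := h T.b
  unfold labelSum endSum
  unfold IsEnd at h1 h2
  split_ifs <;> simp_all

theorem one_le_labelSum {T : LabelledWalk G} {v : V} (h : ∀ s, T.IsEnd v s → s = 1) {s : ℤ}
    (hs : T.IsEnd v s) : 1 ≤ T.labelSum v := by
  obtain rfl := h s hs
  have h1 := h T.a
  have h2 := h T.b
  unfold labelSum endSum
  unfold IsEnd at h1 h2 hs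
  split_ifs <;> simp_all

/-- The edges of the walks in `L` are exactly those in `E`, and at every vertex the values of `f`
on a walk add up to the labels of the walk there. -/
def IsExact (f : Sym2 V → ℤ) (E : List (Sym2 V)) (L : List (LabelledWalk G)) : Prop :=
  (L.flatMap fun T => T.walk.edges).Perm E ∧
    ∀ T ∈ L, ∀ v, edgeSumAt f T.walk.edges v = T.labelSum v

theorem exists_isExact {f : Sym2 V → ℤ} (E : List (Sym2 V)) (hE : ∀ e ∈ E, e ∈ G.edgeSet)
    (hf : ∀ e ∈ E, f e = 1 ∨ f e = -1) : ∃ L : List (LabelledWalk G), IsExact f E L := by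
  induction E with
  | nil => exact ⟨[], by simp [IsExact]⟩
  | cons e E ih =>
    obtain ⟨L, hL1, hL2⟩ := ih (fun e he => hE e (by simp [he])) fun e he => hf e (by simp [he])
    have he := hE e (by simp)
    have hfe := hf e (by simp)
    induction e using Sym2.ind with
    | _ x y =>
      have hxy := G.mem_edgeSet.1 he
      refine ⟨⟨x, y, hxy.toWalk, f s(x, y), f s(x, y), hfe, hfe, by simp⟩ :: L, by simpa using hL1,
        ?_⟩
      intro T hT v
      rcases List.mem_cons.1 hT with rfl | hT
      · have := hxy.ne
        simp only [edgeSumAt, labelSum, endSum, Walk.edges_cons, Walk.edges_nil, List.map_cons,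
          List.map_nil, List.sum_cons, List.sum_nil, Sym2.mem_iff]
        by_cases h1 : x = v
        · subst h1; simp [this, this.symm]
        · by_cases h2 : y = v
          · subst h2; simp [this]
          · simp [h1, h2, Ne.symm h1, Ne.symm h2]
      · exact hL2 T hT v

theorem edgeSumAt_perm {f : Sym2 V → ℤ} {l l' : List (Sym2 V)} (h : l.Perm l') (v : V) :
    edgeSumAt f l v = edgeSumAt f l' v := (h.map _).sum_eq

/-- Joining at opposite labels preserves exactness, because the two labels lost cancel. -/
theorem exists_isExact_pairwise {f : Sym2 V → ℤ} {E : List (Sym2 V)} (hE : ∀ e ∈ E, e ∈ G.edgeSet)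
    (hf : ∀ e ∈ E, f e = 1 ∨ f e = -1) : ∃ L : List (LabelledWalk G), IsExact f E L ∧
      L.Pairwise fun T₁ T₂ => ∀ v s t, T₁.IsEnd v s → T₂.IsEnd v t → s = t := by
  obtain ⟨L₀, hL₀⟩ := exists_isExact E hE hf
  refine List.exists_pairwise_of_merge (Inv := IsExact f E) ?_ ?_ L₀ hL₀
  · rintro l l' h ⟨h1, h2⟩
    exact ⟨(h.symm.flatMap_right _).trans h1, fun T hT => h2 T (h.mem_iff.2 hT)⟩
  · rintro T₁ T₂ l ⟨h1, h2⟩ h3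
    push Not at h3
    obtain ⟨v, s, t, hs, ht, hst⟩ := h3
    obtain ⟨T, hT1, -, -, -, hT2⟩ := exists_join hs ht
    refine ⟨T, ?_, ?_⟩
    · refine List.Perm.trans ?_ h1
      simp only [List.flatMap_cons, ← List.append_assoc]
      exact hT1.append_right _
    · intro T' hT' x
      rcases List.mem_cons.1 hT' with rfl | hT'
      · have hst0 : s + t = 0 := by
          have := hs.eq_or
          have := ht.eq_or
          omega
        rw [hT2, edgeSumAt_perm hT1, ← h2 T₁ (by simp), ← h2 T₂ (by simp), hst0]
        simp [edgeSumAt]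
      · exact h2 T' (by simp [hT']) x

theorem edgeSumAt_flatMap (f : Sym2 V → ℤ) (L : List (LabelledWalk G)) (v : V) :
    edgeSumAt f (L.flatMap fun T => T.walk.edges) v =
      (L.map fun T => edgeSumAt f T.walk.edges v).sum :=
  List.sum_map_flatMap _ _ _

/-- All labels at a vertex shared by distinct walks agree, so a label `1` there would make the
vertex sum at least `2`. -/
theorem IsExact.isBounded [Fintype V] {f : Sym2 V → ℤ} {E : List (Sym2 V)}
    {L : List (LabelledWalk G)} (hL : IsExact f E L)
    (hp : L.Pairwise fun T₁ T₂ => ∀ v s t, T₁.IsEnd v s → T₂.IsEnd v t → s = t)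
    (hv : ∀ v, edgeSumAt f E v ≤ 1) : IsBounded f E L := by
  have hsum : ∀ L', L.Perm L' → ∀ v, (L'.map fun T => T.labelSum v).sum ≤ 1 := by
    intro L' hL' v
    have := hv v
    rw [← edgeSumAt_perm hL.1, edgeSumAt_flatMap, List.map_congr_left fun T hT => hL.2 T hT v] at this
    rwa [← (hL'.map _).sum_eq]
  have hpL : ∀ L', L.Perm L' →
      L'.Pairwise fun T₁ T₂ => ∀ v s t, T₁.IsEnd v s → T₂.IsEnd v t → s = t := fun L' hL' =>
    hp.perm hL' fun h v s t hs ht => (h v t s ht hs).symm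
  refine ⟨hL.1, fun T hT => ?_, ?_⟩
  · have h1 := sum_edgeSumAt (G := G) f T.walk.edges fun e he => T.walk.edges_subset_edgeSet he
    simp_rw [hL.2 T hT, labelSum, sum_endSum] at h1
    refine ⟨h1.ge, fun hc => ?_⟩
    by_contra hlt
    -- A closed walk of positive value has both labels `1`, contributing `2` at its base vertex,
    -- where no other walk contributes negatively.
    have hab : T.a = 1 ∧ T.b = 1 := by
      have := T.ha
      have := T.hb
      omega
    obtain ⟨R, hR⟩ : ∃ R, L.Perm (T :: R) := by
      obtain ⟨s, t, rfl⟩ := List.append_of_mem hT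
      exact ⟨s ++ t, List.perm_middle⟩
    have h2 := (List.pairwise_cons.1 (hpL _ hR)).1
    have h3 : 0 ≤ (R.map fun T' => T'.labelSum T.fst).sum := by
      refine List.sum_nonneg ?_
      simp only [List.mem_map]
      rintro _ ⟨T', hT', rfl⟩
      exact labelSum_nonneg fun s hs => (h2 T' hT' T.fst 1 s (.inl ⟨rfl, hab.1⟩) hs).symm
    have h4 := hsum _ hR T.fst
    rw [List.map_cons, List.sum_cons] at h4
    have h5 : T.labelSum T.fst = 2 := by
      simp [labelSum, endSum, hab, ← hc]
    omega
  · by_contra hnp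
    obtain ⟨T₁, T₂, R, hR, hn⟩ := List.exists_perm_of_not_pairwise hnp
    push Not at hn
    obtain ⟨v, s, t, hs, ht, hst⟩ := hn
    have h1 := hpL _ hR
    rw [List.pairwise_cons, List.pairwise_cons] at h1
    obtain ⟨h1, h2, -⟩ := h1
    have hst' := h1 T₂ (by simp) v s t hs ht
    have hs1 : s = 1 := by
      have := hs.eq_or
      have := ht.eq_or
      by_contra
      exact hst (by omega) (by omega)
    subst hst'
    subst hs1
    have h3 : 0 ≤ (R.map fun T' => T'.labelSum v).sum := by
      refine List.sum_nonneg ?_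
      simp only [List.mem_map]
      rintro _ ⟨T', hT', rfl⟩
      exact labelSum_nonneg fun s hs' => (h2 T' hT' v _ s ht hs').symm
    have h4 := hsum _ hR v
    rw [List.map_cons, List.sum_cons, List.map_cons, List.sum_cons] at h4
    have h5 : 1 ≤ T₁.labelSum v :=
      one_le_labelSum (fun s hs' => h1 T₂ (by simp) v s _ hs' ht) hs
    have h6 : 1 ≤ T₂.labelSum v :=
      one_le_labelSum (fun s hs' => (h1 T₂ (by simp) v _ s hs hs').symm) ht
    omega

/-- The closed walk has value at most `0`, so the bounds for `T₂` survive with the same ends and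
labels. -/
theorem IsBounded.absorb {f : Sym2 V → ℤ} {E : List (Sym2 V)} {l : List (LabelledWalk G)}
    {T₁ T₂ : LabelledWalk G} (hl : IsBounded f E (T₁ :: T₂ :: l)) (hc : T₁.fst = T₁.lst) {x : V}
    (h₁ : x ∈ T₁.walk.support) (h₂ : x ∈ T₂.walk.support) : ∃ T, IsBounded f E (T :: l) := by
  obtain ⟨hl1, hl2, hl3⟩ := hl
  obtain ⟨T, hT, hu, hw, ha, hb⟩ := exists_absorb hc h₁ h₂
  have hs := (hT.map f).sum_eq
  rw [List.map_append, List.sum_append] at hs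
  rw [List.pairwise_cons, List.pairwise_cons] at hl3
  refine ⟨T, ?_, ?_, ?_⟩
  · refine List.Perm.trans ?_ hl1
    simp only [List.flatMap_cons, ← List.append_assoc]
    exact hT.append_right _
  · intro T' hT'
    rcases List.mem_cons.1 hT' with rfl | hT'
    · have h3 := (hl2 T₁ (by simp)).2 hc
      have h4 := hl2 T₂ (by simp)
      rw [hs, hu, hw, ha, hb]
      exact ⟨by linarith [h4.1], fun h => by linarith [h4.2 h]⟩
    · exact hl2 T' (by simp [hT'])
  · refine List.pairwise_cons.2 ⟨fun T' hT' v s t hs' ht => ?_, hl3.2.2⟩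
    refine hl3.2.1 T' hT' v s t ?_ ht
    unfold IsEnd at hs' ⊢
    rwa [← hu, ← hw, ← ha, ← hb]

theorem IsBounded.exists_pairwise {f : Sym2 V → ℤ} {E : List (Sym2 V)} {L₀ : List (LabelledWalk G)}
    (hL₀ : IsBounded f E L₀) :
    ∃ L : List (LabelledWalk G), IsBounded f E L ∧ L.Pairwise Separate := by
  refine List.exists_pairwise_of_merge (Inv := IsBounded f E) (fun l l' h hl => hl.perm h) ?_ L₀ hL₀
  intro T₁ T₂ l hl hn
  by_cases h : ∃ v s t, T₁.IsEnd v s ∧ T₂.IsEnd v t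
  · obtain ⟨v, s, t, hs, ht⟩ := h
    obtain ⟨hl1, hl2, hl3⟩ := hl
    rw [List.pairwise_cons, List.pairwise_cons] at hl3
    obtain ⟨T, hT, hT1, hT2, hab, -⟩ := exists_join hs ht
    have hsum := (hT.map f).sum_eq
    rw [List.map_append, List.sum_append] at hsum
    obtain ⟨rfl, rfl⟩ := hl3.1 T₂ (by simp) v s t hs ht
    have h3 := (hl2 T₁ (by simp)).1
    have h4 := (hl2 T₂ (by simp)).1
    -- Dropping two labels `-1` raises the label sum by `2`. This slack makes the value at most `0`,
    -- as is required if the joined walk is closed.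
    have h5 : 2 * (T.walk.edges.map f).sum ≤ T.a + T.b - 2 := by linarith
    refine ⟨T, ?_, ?_, ?_⟩
    · refine List.Perm.trans ?_ hl1
      simp only [List.flatMap_cons, ← List.append_assoc]
      exact hT.append_right _
    · intro T' hT'
      rcases List.mem_cons.1 hT' with rfl | hT'
      · have := T'.ha
        have := T'.hb
        exact ⟨by linarith, fun _ => by omega⟩
      · exact hl2 T' (by simp [hT'])
    · refine List.pairwise_cons.2 ⟨fun T' hT' x s t hs' ht' => ?_, hl3.2.2⟩
      rcases hs' with ⟨rfl, rfl⟩ | ⟨rfl, rfl⟩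
      · exact hl3.1 T' (by simp [hT']) _ _ _ hT1 ht'
      · exact hl3.2.1 T' hT' _ _ _ hT2 ht'
  · push Not at h
    have : ¬ (T₁.fst = T₁.lst ∨ T₂.fst = T₂.lst → ∀ x ∈ T₁.walk.support, x ∉ T₂.walk.support) :=
      fun h' => hn ⟨h, h'⟩
    push Not at this
    obtain ⟨hc | hc, x, h1, h2⟩ := this
    · exact hl.absorb hc h1 h2
    · exact (hl.perm (List.Perm.swap _ _ _)).absorb hc h2 h1

end LabelledWalk

end SimpleGraph

/-! ### From separate walks to a complete partition -/

namespace SimpleGraph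

section LabelledWalk

variable {V : Type*} {G : SimpleGraph V}

theorem sum_map_emod_two {f : Sym2 V → ℤ} {l : List (Sym2 V)}
    (h : ∀ e ∈ l, f e = 1 ∨ f e = -1) : (l.map f).sum % 2 = (l.length : ℤ) % 2 := by
  induction l with
  | nil => simp
  | cons e l ih =>
    have h1 := ih fun e he => h e (by simp [he])
    have h2 := h e (by simp)
    simp only [List.map_cons, List.sum_cons, List.length_cons]
    push_cast
    omega

variable [DecidableEq V]

theorem Walk.edgeSumAt_one_emod_two {u w : V} (p : G.Walk u w) (v : V) :
    edgeSumAt (fun _ => 1) p.edges v % 2 = endSum u w 1 1 v % 2 := by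
  induction p with
  | nil => simp only [edgeSumAt, endSum, Walk.edges_nil]; split_ifs <;> simp
  | @cons u x w h p ih =>
    have hne := h.ne
    simp only [edgeSumAt, endSum, Walk.edges_cons, List.map_cons, List.sum_cons,
      Sym2.mem_iff] at ih ⊢
    by_cases h1 : u = v
    · subst h1; simp [hne.symm] at ih ⊢; split_ifs at ih ⊢ <;> omega
    · by_cases h2 : x = v
      · subst h2; simp [h1] at ih ⊢; split_ifs at ih ⊢ <;> omega
      · simp [h1, h2, Ne.symm h1, Ne.symm h2] at ih ⊢; exact ih

namespace LabelledWalk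

/-- An edge at a vertex of `T` cannot lie on a walk disjoint from `T`, so the support of `T` is
closed under adjacency and is all of `V`. -/
theorem isEulerianGraph_of_closed (hconn : G.Connected) {T : LabelledWalk G}
    {R : List (LabelledWalk G)} (hc : T.fst = T.lst) (hT : T.walk.edges.Nodup)
    (hE : ∀ e ∈ G.edgeSet, e ∈ (T :: R).flatMap fun T => T.walk.edges)
    (hR : ∀ T' ∈ R, T.Separate T') : G.IsEulerianGraph := by
  have h1 : ∀ x y, G.Adj x y → x ∈ T.walk.support → s(x, y) ∈ T.walk.edges := by
    intro x y hxy hx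
    have := hE s(x, y) hxy
    rw [List.flatMap_cons, List.mem_append, List.mem_flatMap] at this
    rcases this with h | ⟨T', hT', h⟩
    · exact h
    · exact ((hR T' hT').2 (.inl hc) x hx (T'.walk.fst_mem_support_of_mem_edges h)).elim
  have h2 : ∀ x, x ∈ T.walk.support := by
    intro x
    obtain ⟨p⟩ := hconn.preconnected T.fst x
    have : ∀ (y z : V) (_ : G.Walk y z), y ∈ T.walk.support → z ∈ T.walk.support := by
      intro y z p
      induction p with
      | nil => exact id
      | cons h p ih => exact fun hy => ih (T.walk.snd_mem_support_of_mem_edges (h1 _ _ h hy))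
    exact this _ _ p T.walk.start_mem_support
  obtain ⟨u, w, p, a, b, ha, hb, hne⟩ := T
  dsimp only at hc h1 h2 hT
  subst hc
  refine ⟨u, p, Walk.IsTrail.isEulerian_of_forall_mem ⟨hT⟩ fun e he => ?_⟩
  induction e using Sym2.ind with
  | _ x y => exact h1 x y he (h2 x)

theorem exists_isCompletePartition [Fintype V] [DecidableRel G.Adj] {f : Sym2 V → ℤ}
    (hf : ∀ e ∈ G.edgeFinset, f e = 1 ∨ f e = -1) {L : List (LabelledWalk G)}
    (hL : IsBounded f G.edgeFinset.toList L) (hp : L.Pairwise Separate)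
    (hopen : ∀ T ∈ L, T.fst ≠ T.lst) :
    ∃ P : Finpartition G.edgeFinset, G.IsCompletePartition P ∧
      ∑ e ∈ G.edgeFinset, f e ≤ G.oddTrailCount P := by
  have hnd := (hL.1.nodup_iff).2 G.edgeFinset.nodup_toList
  rw [List.nodup_flatMap] at hnd
  set S : LabelledWalk G → Finset (Sym2 V) := fun T => T.walk.edges.toFinset with hS
  have hdisj : L.Pairwise fun T₁ T₂ => Disjoint (S T₁) (S T₂) :=
    hnd.2.imp fun h => by simpa [hS, List.disjoint_toFinset_iff_disjoint] using h
  have hne : ∀ T : LabelledWalk G, S T ≠ ∅ := fun T => by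
    simpa [hS, List.toFinset_eq_empty_iff] using T.edges_ne_nil
  have hmapnd : (L.map S).Nodup := by
    rw [List.Nodup, List.pairwise_map]
    refine hdisj.imp ?_
    intro T₁ T₂ h h'
    rw [h', disjoint_self] at h
    exact hne T₂ h
  let P : Finpartition G.edgeFinset :=
    { parts := (L.map S).toFinset
      supIndep := by
        rw [Finset.supIndep_iff_pairwiseDisjoint]
        have h1 : (L.map S).Pairwise Disjoint := List.pairwise_map.2 hdisj
        intro A hA B hB hAB
        simp only [Finset.mem_coe, List.mem_toFinset] at hA hB
        have : Std.Symm (Disjoint (α := Finset (Sym2 V))) := ⟨fun _ _ h => h.symm⟩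
        exact h1.forall hA hB hAB
      sup_parts := by
        ext e
        have := hL.1.mem_iff (a := e)
        simp only [List.mem_flatMap, Finset.mem_toList] at this
        simp [Finset.mem_sup, hS, ← this]
      bot_notMem := by
        simp only [List.mem_toFinset, List.mem_map, not_exists, not_and]
        exact fun T _ => hne T }
  have hcard : P.parts.card = L.length := by
    rw [List.toFinset_card_of_nodup hmapnd, List.length_map]
  refine ⟨P, ⟨?_, ?_⟩, ?_⟩
  · intro A hA
    obtain ⟨T, hT, rfl⟩ := List.mem_map.1 (List.mem_toFinset.1 hA)
    exact ⟨_, _, T.walk, ⟨hnd.1 T hT⟩, rfl⟩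
  -- `N v` again counts ends at `v`: at most `1`, since the walks are open and share no ends, and
  -- congruent to the degree.
  · set N : V → ℤ := fun v => (L.map fun T => endSum T.fst T.lst 1 1 v).sum with hN
    have hN0 : ∀ v, 0 ≤ N v := fun v => List.sum_nonneg <| by
      simp only [List.mem_map]
      rintro _ ⟨T, -, rfl⟩
      unfold endSum; split_ifs <;> simp
    have hN1 : ∀ v, N v ≤ 1 := by
      intro v
      by_cases h : ∃ T ∈ L, T.fst = v ∨ T.lst = v
      · obtain ⟨T, hT, hv⟩ := h
        obtain ⟨R, hR⟩ : ∃ R, L.Perm (T :: R) := by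
          obtain ⟨s, t, rfl⟩ := List.append_of_mem hT
          exact ⟨s ++ t, List.perm_middle⟩
        have h1 := (List.pairwise_cons.1 (hp.perm hR fun h => h.symm)).1
        obtain ⟨s, hs⟩ : ∃ s, T.IsEnd v s := by
          rcases hv with h | h
          exacts [⟨_, .inl ⟨h, rfl⟩⟩, ⟨_, .inr ⟨h, rfl⟩⟩]
        have h2 : (R.map fun T => endSum T.fst T.lst 1 1 v).sum = 0 := by
          refine List.sum_eq_zero ?_
          simp only [List.mem_map]
          rintro _ ⟨T', hT', rfl⟩
          have h3 : T'.fst ≠ v := fun h => (h1 T' hT').1 v s _ hs (.inl ⟨h, rfl⟩)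
          have h4 : T'.lst ≠ v := fun h => (h1 T' hT').1 v s _ hs (.inr ⟨h, rfl⟩)
          simp [endSum, h3, h4]
        have h5 := hopen T hT
        rw [hN]
        simp only
        rw [(hR.map _).sum_eq, List.map_cons, List.sum_cons, h2, add_zero]
        unfold endSum
        split_ifs with h6 h7
        · exact (h5 (h6.trans h7.symm)).elim
        all_goals simp
      · push Not at h
        refine le_of_eq_of_le (List.sum_eq_zero ?_) zero_le_one
        simp only [List.mem_map]
        rintro _ ⟨T', hT', rfl⟩
        simp [endSum, h T' hT']
    have hNmod : ∀ v, N v % 2 = (G.degree v : ℤ) % 2 := by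
      intro v
      rw [← sum_ite_emod_two (f := fun _ => 1) (by simp), ← Finset.sum_map_toList]
      change _ = edgeSumAt (fun _ => 1) G.edgeFinset.toList v % 2
      rw [← edgeSumAt_perm hL.1, edgeSumAt_flatMap]
      simp only [hN]
      clear * -
      induction L with
      | nil => simp
      | cons T L ih =>
        have := T.walk.edgeSumAt_one_emod_two v
        simp only [List.map_cons, List.sum_cons]
        omega
    have hNeq : ∀ v, N v = if Odd (G.degree v) then 1 else 0 := by
      intro v
      have h0 := hN0 v
      have h1 := hN1 v
      have h2 := hNmod v
      split_ifs with h
      · obtain ⟨m, hm⟩ := h; omega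
      · obtain ⟨m, hm⟩ := Nat.not_odd_iff_even.1 h; omega
    have hNsum : ∑ v, N v = 2 * (L.length : ℤ) := by
      simp only [hN]
      clear * -
      induction L with
      | nil => simp
      | cons T L ih =>
        simp only [List.map_cons, List.sum_cons, Finset.sum_add_distrib, sum_endSum, ih,
          List.length_cons]
        push_cast
        ring
    simp_rw [hNeq, Finset.sum_boole] at hNsum
    rw [hcard]
    exact_mod_cast hNsum.symm
  · have h1 : (G.oddTrailCount P : ℤ) =
        (L.map fun T => if Odd T.walk.edges.length then (1 : ℤ) else 0).sum := by
      rw [oddTrailCount, Finset.card_filter, Nat.cast_sum, List.sum_toFinset _ hmapnd, List.map_map]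
      congr 1
      refine List.map_congr_left fun T hT => ?_
      simp [hS, List.toFinset_card_of_nodup (hnd.1 T hT)]
    rw [h1, ← Finset.sum_map_toList, ← (hL.1.map f).sum_eq, List.sum_map_flatMap]
    -- Each value is at most `1` and has the parity of the length, so even trails have value at most
    -- `0`.
    refine List.sum_le_sum fun T hT => ?_
    have h2 := (hL.2.1 T hT).1
    have h3 := sum_map_emod_two (f := f) (l := T.walk.edges) fun e he =>
      hf e (mem_edgeFinset.2 (T.walk.edges_subset_edgeSet he))
    have h4 := T.ha
    have h5 := T.hb
    split_ifs with h
    · omega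
    · obtain ⟨m, hm⟩ := Nat.not_odd_iff_even.1 h; omega

end LabelledWalk

theorem IsSignedSubmatching.exists_isCompletePartition [Fintype V] [DecidableRel G.Adj]
    (hconn : G.Connected) (hG : ¬ G.IsEulerianGraph) {f : Sym2 V → ℤ}
    (hf : G.IsSignedSubmatching (Fintype.card V) f) :
    ∃ P : Finpartition G.edgeFinset, G.IsCompletePartition P ∧
      ∑ e ∈ G.edgeFinset, f e ≤ G.oddTrailCount P := by
  obtain ⟨hf1, hf2⟩ := isSignedSubmatching_card_iff.1 hf
  obtain ⟨L₀, hL₀, hp₀⟩ := LabelledWalk.exists_isExact_pairwise (G := G) (f := f)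
    (E := G.edgeFinset.toList) (by simp) (fun e he => hf1 e (Finset.mem_toList.1 he))
  obtain ⟨L, hL, hp⟩ := (hL₀.isBounded hp₀ fun v => by
    have := hf2 v
    rwa [← Finset.sum_map_toList] at this).exists_pairwise
  refine LabelledWalk.exists_isCompletePartition hf1 hL hp fun T hT hc => hG ?_
  obtain ⟨R, hR⟩ : ∃ R, L.Perm (T :: R) := by
    obtain ⟨s, t, rfl⟩ := List.append_of_mem hT
    exact ⟨s ++ t, List.perm_middle⟩
  have hnd := (hL.1.nodup_iff).2 G.edgeFinset.nodup_toList
  rw [List.nodup_flatMap] at hnd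
  refine LabelledWalk.isEulerianGraph_of_closed (R := R) hconn hc (hnd.1 T hT) (fun e he => ?_)
    (List.pairwise_cons.1 (hp.perm hR fun h => h.symm)).1
  exact (hL.perm hR).1.mem_iff.2 (by simpa using he)

end LabelledWalk

end SimpleGraph

theorem theorem3 {V : Type*} [Fintype V] [DecidableEq V] (G : SimpleGraph V) [DecidableRel G.Adj]
    (hconn : G.Connected) (hG : ¬ G.IsEulerianGraph) :
    IsGreatest (G.signedSubmatchingValues (Fintype.card V))
        (G.signedSubmatchingNumber (Fintype.card V)) ∧
      IsGreatest G.oddTrailCounts G.completePartitionEta ∧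
      G.signedSubmatchingNumber (Fintype.card V) = (G.completePartitionEta : ℤ) := by
  have := hconn.nonempty
  have hle : ∀ s ∈ G.signedSubmatchingValues (Fintype.card V), ∃ t ∈ G.oddTrailCounts,
      s ≤ (t : ℤ) := by
    rintro _ ⟨f, hf, rfl⟩
    obtain ⟨P, hP, h⟩ := hf.exists_isCompletePartition hconn hG
    exact ⟨_, ⟨P, hP, rfl⟩, h⟩
  have hmem : ∀ t ∈ G.oddTrailCounts,
      (t : ℤ) ∈ G.signedSubmatchingValues (Fintype.card V) := by
    rintro _ ⟨P, hP, rfl⟩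
    exact hP.oddTrailCount_mem
  have hne : G.oddTrailCounts.Nonempty := by
    -- The constant `-1` is a submatching, so the converse construction yields at least one complete
    -- partition.
    have h1 : G.IsSignedSubmatching (Fintype.card V) fun _ => -1 := by
      refine SimpleGraph.isSignedSubmatching_card_iff.2 ⟨by simp, fun v => ?_⟩
      refine le_trans (Finset.sum_nonpos fun e _ => ?_) zero_le_one
      split_ifs <;> simp
    obtain ⟨t, ht, -⟩ := hle _ ⟨_, h1, rfl⟩
    exact ⟨t, ht⟩
  have hbdd : BddAbove G.oddTrailCounts := by
    refine ⟨Fintype.card V, ?_⟩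
    rintro _ ⟨P, hP, rfl⟩
    have h1 := hP.2
    have h2 : G.oddTrailCount P ≤ P.parts.card := Finset.card_filter_le _ _
    have h3 := Finset.card_le_univ (Finset.univ.filter fun v : V => Odd (G.degree v))
    omega
  have heta : IsGreatest G.oddTrailCounts G.completePartitionEta :=
    ⟨Nat.sSup_mem hne hbdd, fun t ht => le_csSup hbdd ht⟩
  have hval : IsGreatest (G.signedSubmatchingValues (Fintype.card V))
      (G.completePartitionEta : ℤ) := by
    refine ⟨hmem _ heta.1, fun s hs => ?_⟩
    obtain ⟨t, ht, hst⟩ := hle s hs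
    exact hst.trans (Int.ofNat_le.2 (heta.2 ht))
  have heq : G.signedSubmatchingNumber (Fintype.card V) = (G.completePartitionEta : ℤ) :=
    hval.csSup_eq
  exact ⟨heq ▸ hval, heta, heq⟩
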